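/- Theorem 2.1 (Arnold's theorem). Let $$J=\bigoplus_{i=1}^t\bigl(J_{m_{i1}}(\lambda_i)\oplus\dots\oplus J_{m_{ir_i}}(\lambda_i)\bigr),\qquad m_{i1}\ge m_{i2}\ge\dots\ge m_{ir_i},$$ be a complex $n\times n$ Jordan matrix, where $\lambda_1,\dots,\lambda_t$ are distinct and $J_m(\lambda)$ is the $m\times m$ Jordan block with $\lambda$ on the diagonal and $1$ on the superdiagonal. Let $\mathcal D$ be the following matrix of zeros and stars, partitioned into blocks conformally with $J$. All blocks whose row strip and column strip belong to different eigenvalues are zero. For each $i$, the $m_{ij}\times m_{ik}$ block of $\mathcal D$ in the row strip of $J_{m_{ij}}(\lambda_i)$ and the column strip of $J_{m_{ik}}(\lambda_i)$ has stars in its last row and zeros elsewhere if $j\le k$, and stars in its first column and zeros elsewhere if $j>k$. (a) There are a map $\mathcal S$ from $\mathbb C^{n\times n}$ to $\mathbb C^{n\times n}$, analytic at $0$ with $\mathcal S(0)=I$, and a map $X\mapsto\mathcal D(X)\in\mathbb C^{n\times n}$, analytic at $0$, such that for all $X$ in a neighbourhood of $0$ the matrix $\mathcal S(X)$ is nonsingular,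 $\mathcal S(X)^{-1}(J+X)\mathcal S(X)=J+\mathcal D(X)$, and $\mathcal D(X)$ is obtained from $\mathcal D$ by replacing the stars by complex numbers. (b) The number of stars in $\mathcal D$ is the least that can be achieved by such transformations: if (a) holds, for some $\mathcal S$ as there, with $\mathcal D$ replaced by a matrix $\mathcal D'$ of zeros and stars with arbitrarily placed stars, then $\mathcal D'$ has at least as many stars as $\mathcal D$. More generally, let $F$ be a map from $\mathbb C^k$ to $\mathbb C^{n\times n}$, analytic at $0$, with $F(0)=J$. If there are an $\mathcal S$, analytic at $0$ with $\mathcal S(0)=I$, and a map $\eta$ from $\mathbb C^{n\times n}$ to $\mathbb C^k$, analytic at $0$ with $\eta(0)=0$, such that $\mathcal S(X)$ is nonsingular and $\mathcal S(X)^{-1}(J+X)\mathcal S(X)=F(\eta(X))$ for all $X$ in a neighbourhood of $0$, then $k$ is at least the number of stars in $\mathcal D$. (c) The number of stars in $\mathcal D$ is equal to the codimension of the similarity class of $J$, that is, to $n^2-\dim_{\mathbb C}\{XJ-JX\mid X\in\mathbb C^{n\times n}\}$. -/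

import Mathlib

open Filter Topology

-- Spaces of complex matrices carry the entrywise sup norm; only the (norm-independent) notions
-- "neighbourhood of 0" and "analytic at 0" are used.
attribute [local instance] Matrix.normedAddCommGroup Matrix.normedSpace

/-- The upper triangular `m × m` Jordan block with eigenvalue `c`. -/
def jordanBlock (m : ℕ) (c : ℂ) : Matrix (Fin m) (Fin m) ℂ :=
  Matrix.of fun a b => if a = b then c else if a.val + 1 = b.val then 1 else 0

/-- Row and column indices of a Jordan matrix whose `j`-th block for the `i`-th eigenvalue has size
`m i j`: the triple `⟨i, j, a⟩` is the `a`-th position inside that block. -/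
abbrev JordanIndex {t : ℕ} {r : Fin t → ℕ} (m : (i : Fin t) → Fin (r i) → ℕ) : Type :=
  (i : Fin t) × (j : Fin (r i)) × Fin (m i j)

/-- The Jordan matrix `⨁ i, (J_{m i 0}(c i) ⊕ J_{m i 1}(c i) ⊕ ⋯)`. -/
def jordanMatrix {t : ℕ} {r : Fin t → ℕ} (c : Fin t → ℂ) (m : (i : Fin t) → Fin (r i) → ℕ) :
    Matrix (JordanIndex m) (JordanIndex m) ℂ :=
  Matrix.blockDiagonal' fun i => Matrix.blockDiagonal' fun j => jordanBlock (m i j) (c i)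

/-- The positions of the stars. Within the part that belongs to one eigenvalue, the block in block
row `j` and block column `k` has its stars in its last row if `j ≤ k`, and in its first column if
`k < j`. There are no stars between different eigenvalues. -/
def starPositions {t : ℕ} {r : Fin t → ℕ} (m : (i : Fin t) → Fin (r i) → ℕ) :
    Finset (JordanIndex m × JordanIndex m) :=
  Finset.univ.filter fun p =>
    p.1.1 = p.2.1 ∧
      ((p.1.2.1.val ≤ p.2.2.1.val ∧ p.1.2.2.val + 1 = m p.1.1 p.1.2.1) ∨
        (p.2.2.1.val < p.1.2.1.val ∧ p.2.2.2.val = 0))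

section Deformations

variable {ι : Type} [Fintype ι] [DecidableEq ι]

/-- All matrices `A + X` close to `A` can be simultaneously reduced, by a similarity
`S(X)⁻¹ (A + X) S(X)` with `S` analytic at `0` and `S(0) = I`, to the form `A + D`, where the
entries of `D` at positions in `P` (the stars) are analytic functions of `X` and the entries at
all other positions are zero. -/
def ReducesToPattern (A : Matrix ι ι ℂ) (P : Finset (ι × ι)) : Prop :=
  ∃ S D : Matrix ι ι ℂ → Matrix ι ι ℂ,
    AnalyticAt ℂ S 0 ∧ S 0 = 1 ∧ AnalyticAt ℂ D 0 ∧
      ∀ᶠ X in 𝓝 (0 : Matrix ι ι ℂ),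
        IsUnit (S X) ∧ (S X)⁻¹ * (A + X) * S X = A + D X ∧
          ∀ p : ι × ι, p ∉ P → D X p.1 p.2 = 0

/-- `F` is a `k`-parameter family of matrices, analytic at the parameter `0`, with `F(0) = A`, and
all matrices `A + X` close to `A` can be simultaneously reduced, by a similarity
`S(X)⁻¹ (A + X) S(X)` with `S` analytic at `0` and `S(0) = I`, to the form `F(η(X))`, where the
parameters `η(X)` are analytic functions of `X` with `η(0) = 0`. -/
def ReducesToFamily (A : Matrix ι ι ℂ) {k : ℕ} (F : (Fin k → ℂ) → Matrix ι ι ℂ) : Prop :=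
  AnalyticAt ℂ F 0 ∧ F 0 = A ∧
    ∃ (S : Matrix ι ι ℂ → Matrix ι ι ℂ) (η : Matrix ι ι ℂ → Fin k → ℂ),
      AnalyticAt ℂ S 0 ∧ S 0 = 1 ∧ AnalyticAt ℂ η 0 ∧ η 0 = 0 ∧
        ∀ᶠ X in 𝓝 (0 : Matrix ι ι ℂ),
          IsUnit (S X) ∧ (S X)⁻¹ * (A + X) * S X = F (η X)

/-- The tangent space `{X A - A X}` at `A` to the similarity class of `A`. -/
def similarityTangent (A : Matrix ι ι ℂ) : Submodule ℂ (Matrix ι ι ℂ) :=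
  LinearMap.range (LinearMap.mulRight ℂ A - LinearMap.mulLeft ℂ A)

theorem mem_similarityTangent (A Y : Matrix ι ι ℂ) :
    Y ∈ similarityTangent A ↔ ∃ X : Matrix ι ι ℂ, X * A - A * X = Y := by
  simp [similarityTangent]

/-- The codimension `n² - dim {X A - A X}` of the similarity class of an `n × n` matrix `A`. -/
noncomputable def similarityCodim (A : Matrix ι ι ℂ) : ℕ :=
  Fintype.card ι ^ 2 - Module.finrank ℂ (similarityTangent A)

/-- The subtraction in `similarityCodim` is not truncated. -/
theorem finrank_similarityTangent_le (A : Matrix ι ι ℂ) :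
    Module.finrank ℂ (similarityTangent A) ≤ Fintype.card ι ^ 2 := by
  have h := Submodule.finrank_le (similarityTangent A)
  rwa [Module.finrank_matrix, Module.finrank_self, mul_one, ← sq] at h

end Deformations

/-! Put `J = jordanMatrix c m`. Everything reduces to linear algebra: the commutators `Y * J - J *
Y` and the matrices supported on the stars form complementary subspaces. Spanning gives (a): linear
maps split each `Z` into a commutator and a starred part, and the implicit function theorem then
yields the analytic reduction (`exists_analyticAt_conjugation`). Conversely, differentiating any
reduction at `0` shows that the commutators and the range of `fderiv ℂ F 0` span, so `k` is at least
the codimension (`similarityCodim_le_of_reducesToFamily`). Complementarity makes that codimension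
the number of stars. To prove it, cut into strips: each strip carries a Sylvester operator `X *
jordanBlock b d - jordanBlock a c * X`. It is bijective for `c ≠ d`; for `c = d` it takes
differences along diagonals, and each star line is a complement of its range. -/

/-! ### Implicit function theorem and linearisation for the conjugation equation -/

section FiniteDimensional

open scoped ContDiff

variable {V : Type*} [NormedAddCommGroup V] [NormedSpace ℂ V] [FiniteDimensional ℂ V]

/-- Given linear solution operators `R`, `D` of the linearised equation `Y A - A Y + E = Z`, the
equation `(A + X) S = S (A + E)` for a bilinear product with unit `e` is solvable for `S` near `e`
and `E` in the range of `D`, analytically in `X`. -/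
theorem exists_analyticAt_conjugation (m : V →ₗ[ℂ] V →ₗ[ℂ] V) (e A : V)
    (hel : ∀ v, m e v = v) (her : ∀ v, m v e = v) (R D : V →ₗ[ℂ] V)
    (hRD : ∀ Z, m (R Z) A - m A (R Z) + D Z = Z) :
    ∃ S E : V → V, AnalyticAt ℂ S 0 ∧ S 0 = e ∧ AnalyticAt ℂ E 0 ∧ (∀ X, ∃ Z, E X = D Z) ∧
      ∀ᶠ X in 𝓝 (0 : V), m (A + X) (S X) = m (S X) (A + E X) := by
  have : CompleteSpace V := FiniteDimensional.complete ℂ V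
  let B : V →L[ℂ] V →L[ℂ] V := m.toContinuousBilinearMap
  have hB : ∀ v w, B v w = m v w := fun _ _ => rfl
  let R' : V →L[ℂ] V := R.toContinuousLinearMap
  let D' : V →L[ℂ] V := D.toContinuousLinearMap
  -- A single unknown `Z = q.2` drives both `S = e + R Z` and `E = D Z`. By `hRD` the partial
  -- derivative in `Z` at `0` is then minus the identity.
  let f : V × V → V := fun q => B (A + q.1) (e + R' q.2) - B (e + R' q.2) (A + D' q.2)
  have hf : ContDiff ℂ ω f := by fun_prop
  have hf0 : f 0 = 0 := by simp [f, hB, hel, her]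
  have hω : (ω : WithTop ℕ∞) ≠ 0 := by simp
  have hfd : (fderiv ℂ f 0).comp (ContinuousLinearMap.inr ℂ V V) = -ContinuousLinearMap.id ℂ V := by
    have h1 : HasFDerivAt (fun Z => f (0, Z))
        ((fderiv ℂ f 0).comp (ContinuousLinearMap.inr ℂ V V)) 0 :=
      HasFDerivAt.comp (0 : V) (g := f) (f := fun Z => (0, Z))
        ((hf.differentiable hω).differentiableAt.hasFDerivAt) (hasFDerivAt_prodMk_right _ _)
    have hR : HasFDerivAt (fun Z => e + R' Z) R' 0 := R'.hasFDerivAt.const_add e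
    have hD : HasFDerivAt (fun Z => A + D' Z) D' 0 := D'.hasFDerivAt.const_add A
    have h2 := (B.hasFDerivAt_of_bilinear
      (hasFDerivAt_const (𝕜 := ℂ) (A + 0) (0 : V)) hR).sub (B.hasFDerivAt_of_bilinear hR hD)
    rw [h1.unique h2]
    ext1 Z
    have h : m A (R Z) - (m e (D Z) + m (R Z) A) = -Z := by
      rw [hel]
      -- The fourth `Z` is the bare one on the right-hand side.
      nth_rewrite 4 [← hRD Z]
      abel
    simpa [hB, R', D'] using h
  have hinv : ((fderiv ℂ f 0).comp (ContinuousLinearMap.inr ℂ V V)).IsInvertible := by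
    rw [hfd]
    exact ⟨ContinuousLinearEquiv.neg ℂ, rfl⟩
  have cdf : ContDiffAt ℂ ω f 0 := hf.contDiffAt
  let ψ := cdf.implicitFunction hω hinv
  have hψ : AnalyticAt ℂ ψ 0 := (cdf.contDiffAt_implicitFunction hω hinv).analyticAt
  have hψ0 : ψ 0 = 0 := cdf.implicitFunction_apply_self hω hinv
  have hev : ∀ᶠ X in 𝓝 (0 : V), f (X, ψ X) = f 0 := cdf.eventually_apply_implicitFunction hω hinv
  refine ⟨fun X => e + R' (ψ X), fun X => D' (ψ X),
    analyticAt_const.add ((R'.analyticAt _).comp hψ), by simp [hψ0], (D'.analyticAt _).comp hψ,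
    fun X => ⟨ψ X, rfl⟩, ?_⟩
  filter_upwards [hev] with X hX
  rw [hf0] at hX
  exact sub_eq_zero.1 hX

/-- The derivative at `0` of the equation `(A + X) S(X) = S(X) F(η(X))`. -/
theorem exists_linearization {K : Type*} [NormedAddCommGroup K] [NormedSpace ℂ K]
    (m : V →ₗ[ℂ] V →ₗ[ℂ] V) (e A : V) (hel : ∀ v, m e v = v) (her : ∀ v, m v e = v)
    {S : V → V} {η : V → K} {F : K → V} (hS : DifferentiableAt ℂ S 0) (hS0 : S 0 = e)
    (hη : DifferentiableAt ℂ η 0) (hη0 : η 0 = 0) (hF : DifferentiableAt ℂ F 0) (hF0 : F 0 = A)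
    (h : ∀ᶠ X in 𝓝 (0 : V), m (A + X) (S X) = m (S X) (F (η X))) :
    ∃ F' : K →ₗ[ℂ] V, ∀ H, ∃ Y z, m Y A - m A Y + F' z = H := by
  let B : V →L[ℂ] V →L[ℂ] V := m.toContinuousBilinearMap
  have hB : ∀ v w, B v w = m v w := fun _ _ => rfl
  have dF : HasFDerivAt F (fderiv ℂ F 0) (η 0) := by
    rw [hη0]
    exact hF.hasFDerivAt
  have dA : HasFDerivAt (fun X => A + X) (ContinuousLinearMap.id ℂ V) (0 : V) :=
    (hasFDerivAt_id _).const_add A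
  have hl := B.hasFDerivAt_of_bilinear dA hS.hasFDerivAt
  have hr := B.hasFDerivAt_of_bilinear hS.hasFDerivAt (dF.comp _ hη.hasFDerivAt)
  have key := hl.unique (hr.congr_of_eventuallyEq h)
  refine ⟨(fderiv ℂ F 0).toLinearMap, fun H => ⟨fderiv ℂ S 0 H, fderiv ℂ η 0 H, ?_⟩⟩
  have hH := congrArg (fun L : V →L[ℂ] V => L H) key
  have hH' : m A (fderiv ℂ S 0 H) + H
      = fderiv ℂ F 0 (fderiv ℂ η 0 H) + m (fderiv ℂ S 0 H) A := by
    simpa [hB, hS0, hη0, hF0, hel, her] using hH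
  rw [ContinuousLinearMap.coe_coe, ← add_right_inj (m A (fderiv ℂ S 0 H)), hH']
  abel

end FiniteDimensional

/-! ### From commutators to reductions, and the parameter count -/

section Deformations

variable {ι : Type} [Fintype ι] [DecidableEq ι]

theorem eventually_isUnit_of_tendsto_one {S : Matrix ι ι ℂ → Matrix ι ι ℂ}
    (hS : ContinuousAt S 0) (h1 : S 0 = 1) :
    ∀ᶠ X in 𝓝 (0 : Matrix ι ι ℂ), IsUnit (S X) := by
  have hdet : ContinuousAt (fun X => (S X).det) 0 :=
    ((continuous_id.matrix_det (A := fun X : Matrix ι ι ℂ => X)).continuousAt).comp hS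
  have hne : (S 0).det ≠ 0 := by simp [h1]
  filter_upwards [hdet.eventually_ne hne] with X hX
  exact (Matrix.isUnit_iff_isUnit_det _).2 (isUnit_iff_ne_zero.2 hX)

/-- If every matrix agrees off `P` with some commutator `Y A - A Y`, there are linear maps that
choose `Y` and the remaining part supported on `P`. -/
theorem exists_linear_splitting {A : Matrix ι ι ℂ} {P : Finset (ι × ι)}
    (h : ∀ Z : Matrix ι ι ℂ, ∃ Y : Matrix ι ι ℂ,
      ∀ p : ι × ι, p ∉ P → (Y * A - A * Y) p.1 p.2 = Z p.1 p.2) :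
    ∃ R D : Matrix ι ι ℂ →ₗ[ℂ] Matrix ι ι ℂ,
      (∀ Z, R Z * A - A * R Z + D Z = Z) ∧ ∀ Z, ∀ p : ι × ι, p ∉ P → D Z p.1 p.2 = 0 := by
  let W : Submodule ℂ (Matrix ι ι ℂ) :=
    { carrier := {D | ∀ p : ι × ι, p ∉ P → D p.1 p.2 = 0}
      add_mem' := fun ha hb p hp => by simp [ha p hp, hb p hp]
      zero_mem' := fun p _ => rfl
      smul_mem' := fun a D hD p hp => by simp [hD p hp] }
  let Φ : Matrix ι ι ℂ × W →ₗ[ℂ] Matrix ι ι ℂ :=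
    (LinearMap.mulRight ℂ A - LinearMap.mulLeft ℂ A).coprod W.subtype
  have hΦ : ∀ q, Φ q = q.1 * A - A * q.1 + q.2 := fun q => by simp [Φ]
  have hsurj : LinearMap.range Φ = ⊤ := by
    rw [LinearMap.range_eq_top]
    intro Z
    obtain ⟨Y, hY⟩ := h Z
    refine ⟨(Y, ⟨Z - (Y * A - A * Y), fun p hp => ?_⟩), ?_⟩
    · rw [Matrix.sub_apply, hY p hp, sub_self]
    · rw [hΦ]
      simp
  obtain ⟨Ψ, hΨ⟩ := Φ.exists_rightInverse_of_surjective hsurj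
  refine ⟨LinearMap.fst ℂ _ _ ∘ₗ Ψ, W.subtype ∘ₗ LinearMap.snd ℂ _ _ ∘ₗ Ψ, fun Z => ?_,
    fun Z => (Ψ Z).2.2⟩
  have := LinearMap.congr_fun hΨ Z
  simpa [hΦ] using this

/-- If the matrices supported on `P` together with the commutators `Y A - A Y` span all matrices,
then all matrices near `A` reduce to the pattern `P`. -/
theorem reducesToPattern_of_span {A : Matrix ι ι ℂ} {P : Finset (ι × ι)}
    (h : ∀ Z : Matrix ι ι ℂ, ∃ Y : Matrix ι ι ℂ,
      ∀ p : ι × ι, p ∉ P → (Y * A - A * Y) p.1 p.2 = Z p.1 p.2) :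
    ReducesToPattern A P := by
  obtain ⟨R, D, hRD, hD⟩ := exists_linear_splitting h
  obtain ⟨S, E, hS, hS1, hE, hED, hev⟩ := exists_analyticAt_conjugation
    (LinearMap.mul ℂ (Matrix ι ι ℂ)) 1 A one_mul mul_one R D hRD
  refine ⟨S, E, hS, hS1, hE, ?_⟩
  filter_upwards [hev, eventually_isUnit_of_tendsto_one hS.continuousAt hS1] with X hX hu
  rw [LinearMap.mul_apply', LinearMap.mul_apply'] at hX
  refine ⟨hu, ?_, ?_⟩
  · rw [mul_assoc, hX, ← mul_assoc,
      Matrix.nonsing_inv_mul _ ((Matrix.isUnit_iff_isUnit_det _).1 hu), one_mul]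
  · obtain ⟨Z, hZ⟩ := hED X
    rw [hZ]
    exact hD Z

/-- A family to which all matrices near `A` reduce is transversal to the similarity class of `A`,
so it has at least as many parameters as the codimension of this class. -/
theorem similarityCodim_le_of_reducesToFamily {A : Matrix ι ι ℂ} {k : ℕ}
    {F : (Fin k → ℂ) → Matrix ι ι ℂ} (h : ReducesToFamily A F) : similarityCodim A ≤ k := by
  obtain ⟨hF, hF0, S, η, hS, hS1, hη, hη0, hev⟩ := h
  have heq : ∀ᶠ X in 𝓝 (0 : Matrix ι ι ℂ), LinearMap.mul ℂ (Matrix ι ι ℂ) (A + X) (S X)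
      = LinearMap.mul ℂ (Matrix ι ι ℂ) (S X) (F (η X)) := by
    filter_upwards [hev] with X hX
    rw [LinearMap.mul_apply', LinearMap.mul_apply', ← hX.2, mul_assoc, ← mul_assoc (S X),
      Matrix.mul_nonsing_inv _ ((Matrix.isUnit_iff_isUnit_det _).1 hX.1), one_mul]
  obtain ⟨F', hF'⟩ := exists_linearization (LinearMap.mul ℂ (Matrix ι ι ℂ)) 1 A one_mul mul_one
    hS.differentiableAt hS1 hη.differentiableAt hη0 hF.differentiableAt hF0 heq
  have htop : similarityTangent A ⊔ LinearMap.range F' = ⊤ := by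
    rw [eq_top_iff]
    intro H _
    obtain ⟨Y, z, hYz⟩ := hF' H
    exact Submodule.mem_sup.2 ⟨_, (mem_similarityTangent A _).2 ⟨Y, rfl⟩, _, ⟨z, rfl⟩, hYz⟩
  have h1 := Submodule.finrank_add_le_finrank_add_finrank (similarityTangent A)
    (LinearMap.range F')
  have h2 : Module.finrank ℂ (LinearMap.range F') ≤ k := by
    simpa using LinearMap.finrank_range_le F'
  rw [htop, finrank_top, Module.finrank_matrix, Module.finrank_self, mul_one, ← sq] at h1
  unfold similarityCodim
  omega

/-- A pattern with `P.card` stars is a family with `P.card` parameters. -/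
theorem ReducesToPattern.exists_reducesToFamily {A : Matrix ι ι ℂ} {P : Finset (ι × ι)}
    (h : ReducesToPattern A P) :
    ∃ F : (Fin P.card → ℂ) → Matrix ι ι ℂ, ReducesToFamily A F := by
  obtain ⟨S, D, hS, hS1, hD, hev⟩ := h
  -- At `X = 0` the reduction reads `A = A + D 0`.
  have hD0 : D 0 = 0 := by
    have := hev.self_of_nhds.2.1
    simpa [hS1] using this
  let Lin : (Fin P.card → ℂ) →ₗ[ℂ] Matrix ι ι ℂ :=
    ∑ i, (Matrix.singleLinearMap ℂ (P.equivFin.symm i).1.1 (P.equivFin.symm i).1.2) ∘ₗ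
      LinearMap.proj i
  let ent : Matrix ι ι ℂ →ₗ[ℂ] (Fin P.card → ℂ) :=
    LinearMap.pi fun i => Matrix.entryLinearMap ℂ ℂ (P.equivFin.symm i).1.1 (P.equivFin.symm i).1.2
  have hLin : ∀ M : Matrix ι ι ℂ, (∀ p : ι × ι, p ∉ P → M p.1 p.2 = 0) → Lin (ent M) = M := by
    intro M hM
    have e1 : Lin (ent M) = ∑ p ∈ P, Matrix.single p.1 p.2 (M p.1 p.2) := by
      rw [← Finset.sum_coe_sort, ← Equiv.sum_comp P.equivFin.symm]
      simp [Lin, ent]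
    have e2 : ∑ p ∈ P, Matrix.single p.1 p.2 (M p.1 p.2)
        = ∑ p : ι × ι, Matrix.single p.1 p.2 (M p.1 p.2) :=
      Finset.sum_subset (Finset.subset_univ _) fun p _ hp => by rw [hM p hp, Matrix.single_zero]
    rw [e1, e2, Fintype.sum_prod_type]
    exact (Matrix.matrix_eq_sum_single M).symm
  refine ⟨fun z => A + Lin.toContinuousLinearMap z,
    analyticAt_const.add (ContinuousLinearMap.analyticAt _ _), by simp,
    S, fun X => ent.toContinuousLinearMap (D X), hS, hS1,
    (ContinuousLinearMap.analyticAt _ _).comp hD, by simp [hD0], ?_⟩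
  filter_upwards [hev] with X hX
  refine ⟨hX.1, ?_⟩
  rw [hX.2.1]
  simp [hLin _ hX.2.2]

/-- If the matrices supported on `P` form a complement of the space of commutators `Y A - A Y`,
then the codimension of the similarity class is the number of positions in `P`. -/
theorem card_eq_similarityCodim {A : Matrix ι ι ℂ} {P : Finset (ι × ι)}
    (hspan : ∀ Z : Matrix ι ι ℂ, ∃ Y : Matrix ι ι ℂ,
      ∀ p : ι × ι, p ∉ P → (Y * A - A * Y) p.1 p.2 = Z p.1 p.2)
    (hind : ∀ Y : Matrix ι ι ℂ, (∀ p : ι × ι, p ∉ P → (Y * A - A * Y) p.1 p.2 = 0) →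
      Y * A - A * Y = 0) :
    P.card = similarityCodim A := by
  -- Reading off the entries outside `P` is an isomorphism on the tangent space: `hind` gives
  -- injectivity, `hspan` surjectivity.
  let ρ : Matrix ι ι ℂ →ₗ[ℂ] ({p : ι × ι // p ∉ P} → ℂ) :=
    LinearMap.pi fun p => Matrix.entryLinearMap ℂ ℂ p.1.1 p.1.2
  have hbij : Function.Bijective (ρ.domRestrict (similarityTangent A)) := by
    constructor
    · rw [injective_iff_map_eq_zero]
      rintro ⟨M, hM⟩ h0
      obtain ⟨Y, rfl⟩ := (mem_similarityTangent A M).1 hM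
      exact Subtype.ext (hind Y fun p hp => congrFun h0 ⟨p, hp⟩)
    · intro g
      obtain ⟨Y, hY⟩ := hspan (Matrix.of fun a b => if h : (a, b) ∉ P then g ⟨(a, b), h⟩ else 0)
      refine ⟨⟨Y * A - A * Y, (mem_similarityTangent A _).2 ⟨Y, rfl⟩⟩, funext fun p => ?_⟩
      refine (hY p.1 p.2).trans ?_
      simp [p.2]
  have hfr := (LinearEquiv.ofBijective _ hbij).finrank_eq
  have hcard : Fintype.card {p : ι × ι // p ∉ P} = Fintype.card ι ^ 2 - P.card := by
    rw [Fintype.card_subtype_compl, Fintype.card_prod, Fintype.card_coe, sq]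
  have hle : P.card ≤ Fintype.card ι ^ 2 := by
    rw [sq, ← Fintype.card_prod]
    exact Finset.card_le_univ P
  rw [Module.finrank_fintype_fun_eq_card, hcard] at hfr
  unfold similarityCodim
  omega

end Deformations

/-! ### The Sylvester operator of two Jordan blocks -/

/-- The extension of an `a × b` matrix by zeros, with the column index shifted by one: column `0` of
the extension is zero and column `s + 1` is column `s` of the matrix. -/
def shiftExtend {a b : ℕ} (X : Matrix (Fin a) (Fin b) ℂ) (r s : ℕ) : ℂ :=
  if h : r < a ∧ 0 < s ∧ s - 1 < b then X ⟨r, h.1⟩ ⟨s - 1, h.2.2⟩ else 0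

section JordanBlocks

variable {a b : ℕ}

theorem shiftExtend_zero_right (X : Matrix (Fin a) (Fin b) ℂ) (r : ℕ) :
    shiftExtend X r 0 = 0 := by
  simp [shiftExtend]

theorem shiftExtend_of_le (X : Matrix (Fin a) (Fin b) ℂ) {r : ℕ} (h : a ≤ r) (s : ℕ) :
    shiftExtend X r s = 0 := by
  simp [shiftExtend, h.not_gt]

theorem shiftExtend_succ (X : Matrix (Fin a) (Fin b) ℂ) (r : Fin a) (s : Fin b) :
    shiftExtend X r (s + 1) = X r s := by
  simp [shiftExtend]

theorem shiftExtend_of (g : ℕ → ℕ → ℂ) {r s : ℕ} (hr : r < a) (hs : s ≤ b) (hg : g r 0 = 0) :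
    shiftExtend (Matrix.of fun (i : Fin a) (j : Fin b) => g i (j + 1)) r s = g r s := by
  rcases s with _ | s
  · rw [shiftExtend_zero_right, hg]
  · exact shiftExtend_succ _ ⟨r, hr⟩ ⟨s, hs⟩

theorem mul_jordanBlock_apply (X : Matrix (Fin a) (Fin b) ℂ) (c : ℂ) (r : Fin a) (s : Fin b) :
    (X * jordanBlock b c) r s = c * X r s + shiftExtend X r s := by
  have h : ∀ k : Fin b, X r k * jordanBlock b c k s
      = (if k = s then c * X r k else 0) + if k.val + 1 = s.val then X r k else 0 := by
    intro k
    by_cases h1 : k = s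
    · simp [jordanBlock, h1, mul_comm]
    · simp [jordanBlock, h1]
  rw [Matrix.mul_apply, Finset.sum_congr rfl fun k _ => h k, Finset.sum_add_distrib]
  congr 1
  · simp
  · obtain ⟨s, hs⟩ := s
    rcases s with _ | s
    · simp [shiftExtend_zero_right]
    · rw [Finset.sum_eq_single ⟨s, by omega⟩]
      · simp [shiftExtend]
        omega
      · intro k _ hk
        rw [if_neg]
        intro h
        exact hk (Fin.ext (by simpa using h))
      · simp

theorem jordanBlock_mul_apply (X : Matrix (Fin a) (Fin b) ℂ) (c : ℂ) (r : Fin a) (s : Fin b) :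
    (jordanBlock a c * X) r s = c * X r s + shiftExtend X (r + 1) (s + 1) := by
  have h : ∀ k : Fin a, jordanBlock a c r k * X k s
      = (if r = k then c * X k s else 0) + if r.val + 1 = k.val then X k s else 0 := by
    intro k
    by_cases h1 : r = k
    · simp [jordanBlock, h1]
    · simp [jordanBlock, h1]
  rw [Matrix.mul_apply, Finset.sum_congr rfl fun k _ => h k, Finset.sum_add_distrib]
  congr 1
  · simp
  · by_cases hr : r.val + 1 < a
    · rw [Finset.sum_eq_single ⟨r + 1, hr⟩]
      · simp [shiftExtend, hr]
      · intro k _ hk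
        rw [if_neg]
        intro h
        exact hk (Fin.ext h.symm)
      · simp
    · rw [shiftExtend_of_le _ (not_lt.1 hr)]
      refine Finset.sum_eq_zero fun k _ => if_neg ?_
      omega

/-- The nilpotent parts contribute the left neighbour minus the neighbour below. In `shiftExtend`
coordinates these are consecutive places on one diagonal, with zeros past the left and bottom edges.
-/
theorem sylvester_jordanBlock_apply (X : Matrix (Fin a) (Fin b) ℂ) (c d : ℂ)
    (r : Fin a) (s : Fin b) :
    (X * jordanBlock b d - jordanBlock a c * X) r s
      = (d - c) * X r s + shiftExtend X r s - shiftExtend X (r + 1) (s + 1) := by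
  rw [Matrix.sub_apply, mul_jordanBlock_apply, jordanBlock_mul_apply]
  ring

/-- The entries computed by the recursion down the diagonals for the last row normal form. -/
def diagonalRecursion (y : ℕ → ℕ → ℂ) : ℕ → ℕ → ℂ
  | r + 1, s + 1 => diagonalRecursion y r s - y r s
  | _, _ => 0

/-- Solve down each diagonal, starting from `0` in row `0` (a free choice) or column `0` (forced by
the extension). Only in the last row is the next value also forced, being below the matrix. -/
theorem exists_sylvester_eq_off_last_row (c : ℂ) (Z : Matrix (Fin a) (Fin b) ℂ) :
    ∃ X : Matrix (Fin a) (Fin b) ℂ, ∀ r s, ¬ r.val + 1 = a →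
      (X * jordanBlock b c - jordanBlock a c * X) r s = Z r s := by
  let g := diagonalRecursion fun r s => shiftExtend Z r (s + 1)
  have hg : ∀ r, g r 0 = 0 := fun r => by cases r <;> rfl
  refine ⟨Matrix.of fun i j => g i (j + 1), fun r s hr => ?_⟩
  have := r.2
  rw [sylvester_jordanBlock_apply, shiftExtend_of g r.2 s.2.le (hg _),
    shiftExtend_of g (by omega) s.2 (hg _)]
  change _ + g r s - (g r s - shiftExtend Z r (s + 1)) = _
  rw [shiftExtend_succ]
  ring

theorem exists_sylvester_eq_off_first_column (c : ℂ) (Z : Matrix (Fin a) (Fin b) ℂ) :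
    ∃ X : Matrix (Fin a) (Fin b) ℂ, ∀ r s, ¬ s.val = 0 →
      (X * jordanBlock b c - jordanBlock a c * X) r s = Z r s := by
  -- Sum `Z` from a position down its diagonal, so that consecutive sums differ by one entry; `a`
  -- terms suffice because rows from `a` on vanish. The forced `0` at `s = 0` spoils only the
  -- equations of the first column.
  let g : ℕ → ℕ → ℂ := fun r s =>
    if s = 0 then 0 else ∑ k ∈ Finset.range a, shiftExtend Z (r + k) (s + k + 1)
  have hg : ∀ r, g r 0 = 0 := fun r => by simp [g]
  have hga : ∀ r s, a ≤ r → g r s = 0 := fun r s h => by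
    have : ∀ k, shiftExtend Z (r + k) (s + k + 1) = 0 := fun k => shiftExtend_of_le Z (by omega) _
    simp [g, this]
  have hext : ∀ r s, s ≤ b →
      shiftExtend (Matrix.of fun (i : Fin a) (j : Fin b) => g i (j + 1)) r s = g r s := by
    intro r s hs
    rcases lt_or_ge r a with h | h
    · exact shiftExtend_of g h hs (hg _)
    · rw [shiftExtend_of_le _ h, hga _ _ h]
  refine ⟨Matrix.of fun i j => g i (j + 1), fun r s hs => ?_⟩
  rw [sylvester_jordanBlock_apply, hext _ _ s.2.le, hext _ _ s.2, sub_self, zero_mul, zero_add]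
  have h1 : g r s = ∑ k ∈ Finset.range (a + 1), shiftExtend Z (r + k) (s + k + 1) := by
    rw [Finset.sum_range_succ, shiftExtend_of_le Z (by omega), add_zero]
    simp [g, hs]
  have h2 : g (r + 1) (s + 1)
      = ∑ k ∈ Finset.range a, shiftExtend Z (r + (k + 1)) (s + (k + 1) + 1) := by
    simp only [g, Nat.succ_ne_zero, if_false]
    refine Finset.sum_congr rfl fun k _ => ?_
    congr 1 <;> ring
  rw [h1, h2, Finset.sum_range_succ', add_sub_cancel_left]
  exact shiftExtend_succ Z r s

/-- Off the last row, the extension is constant along diagonals. Since `b ≤ a`, the diagonal through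
a last-row value read by the operator runs up-left into the zero column `0`, so that value vanishes.
-/
theorem sylvester_eq_zero_of_last_row (hab : b ≤ a) (c : ℂ) (X : Matrix (Fin a) (Fin b) ℂ)
    (h : ∀ r s, ¬ r.val + 1 = a → (X * jordanBlock b c - jordanBlock a c * X) r s = 0) :
    X * jordanBlock b c - jordanBlock a c * X = 0 := by
  simp only [sylvester_jordanBlock_apply, sub_self, zero_mul, zero_add] at h
  have hlow : ∀ s r : ℕ, s ≤ r → r < a → s ≤ b → shiftExtend X r s = 0 := by
    intro s
    induction s with
    | zero => intro r _ _ _; exact shiftExtend_zero_right X r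
    | succ s ih =>
      intro r hsr hr hs
      obtain ⟨r, rfl⟩ : ∃ q, r = q + 1 := ⟨r - 1, by omega⟩
      have := h ⟨r, by omega⟩ ⟨s, hs⟩ (by simp; omega)
      rw [ih r (by omega) (by omega) (by omega), zero_sub, neg_eq_zero] at this
      exact this
  ext r s
  rw [Matrix.zero_apply]
  by_cases hr : r.val + 1 = a
  · rw [sylvester_jordanBlock_apply, shiftExtend_of_le X hr.ge,
      hlow s r (by omega) r.2 s.2.le]
    simp
  · rw [sylvester_jordanBlock_apply, sub_self, zero_mul, zero_add]
    exact h r s hr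

/-- A value read in the first column lies on a diagonal that, since `a ≤ b`, leaves through the
bottom edge, where the extension is zero, before crossing the right edge. -/
theorem sylvester_eq_zero_of_first_column (hab : a ≤ b) (c : ℂ) (X : Matrix (Fin a) (Fin b) ℂ)
    (h : ∀ r s, ¬ s.val = 0 → (X * jordanBlock b c - jordanBlock a c * X) r s = 0) :
    X * jordanBlock b c - jordanBlock a c * X = 0 := by
  simp only [sylvester_jordanBlock_apply, sub_self, zero_mul, zero_add] at h
  have hlow : ∀ k r s : ℕ, a ≤ r + k → s ≤ r → shiftExtend X r s = 0 := by
    intro k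
    induction k with
    | zero => intro r s hr _; exact shiftExtend_of_le X (by omega) s
    | succ k ih =>
      intro r s hr hs
      rcases Nat.eq_zero_or_pos s with rfl | h0
      · exact shiftExtend_zero_right X r
      rcases lt_or_ge r a with hra | hra
      · have := h ⟨r, hra⟩ ⟨s, by omega⟩ (by simp; omega)
        rw [ih (r + 1) (s + 1) (by omega) (by omega), sub_zero] at this
        exact this
      · exact shiftExtend_of_le X hra s
  ext r s
  rw [Matrix.zero_apply]
  by_cases hs : s.val = 0
  · rw [sylvester_jordanBlock_apply, hs, shiftExtend_zero_right,
      hlow a (r + 1) (0 + 1) (by omega) (by omega)]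
    simp
  · rw [sylvester_jordanBlock_apply, sub_self, zero_mul, zero_add]
    exact h r s hs

/-- Each entry times `d - c` is a combination of its left and lower neighbours, so zeros propagate
from the bottom left corner. -/
theorem eq_zero_of_sylvester_eq_zero {c d : ℂ} (hcd : c ≠ d) (X : Matrix (Fin a) (Fin b) ℂ)
    (h : X * jordanBlock b d - jordanBlock a c * X = 0) : X = 0 := by
  have h' : ∀ r s, (d - c) * X r s + shiftExtend X r s - shiftExtend X (r + 1) (s + 1) = 0 :=
    fun r s => by rw [← sylvester_jordanBlock_apply, h, Matrix.zero_apply]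
  -- Here `n` bounds the distance `(a - r) + s` from that corner.
  have key : ∀ n r s : ℕ, a + s ≤ r + n → s ≤ b → shiftExtend X r s = 0 := by
    intro n
    induction n with
    | zero => intro r s hr _; exact shiftExtend_of_le X (by omega) s
    | succ n ih =>
      intro r s hr hs
      rcases s with _ | s
      · exact shiftExtend_zero_right X r
      rcases lt_or_ge r a with hra | hra
      · have := h' ⟨r, hra⟩ ⟨s, hs⟩
        rw [ih r s (by omega) (by omega), ih (r + 1) (s + 1) (by omega) hs, add_zero, sub_zero,
          mul_eq_zero, sub_eq_zero] at this
        exact (shiftExtend_succ X ⟨r, hra⟩ ⟨s, hs⟩).trans (this.resolve_left hcd.symm)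
      · exact shiftExtend_of_le X hra _
  ext r s
  rw [← shiftExtend_succ X]
  exact key (a + b) _ _ (by omega) s.2

theorem exists_sylvester_eq {c d : ℂ} (hcd : c ≠ d) (Z : Matrix (Fin a) (Fin b) ℂ) :
    ∃ X : Matrix (Fin a) (Fin b) ℂ, X * jordanBlock b d - jordanBlock a c * X = Z := by
  let L : Matrix (Fin a) (Fin b) ℂ →ₗ[ℂ] Matrix (Fin a) (Fin b) ℂ :=
    { toFun := fun X => X * jordanBlock b d - jordanBlock a c * X
      map_add' := fun X Y => by simp only [Matrix.add_mul, Matrix.mul_add]; abel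
      map_smul' := fun z X => by simp [smul_sub] }
  have hinj : Function.Injective L :=
    (injective_iff_map_eq_zero L).2 fun X hX => eq_zero_of_sylvester_eq_zero hcd X hX
  exact LinearMap.injective_iff_surjective.1 hinj Z

end JordanBlocks

/-! ### Assembling the strips -/

section JordanMatrix

variable {t : ℕ} {r : Fin t → ℕ} {m : (i : Fin t) → Fin (r i) → ℕ}

/-- The block of a matrix in the row strip `(i, j)` and the column strip `(i', k)`. -/
def jordanStrip (X : Matrix (JordanIndex m) (JordanIndex m) ℂ) (i : Fin t) (j : Fin (r i))
    (i' : Fin t) (k : Fin (r i')) : Matrix (Fin (m i j)) (Fin (m i' k)) ℂ :=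
  Matrix.of fun u v => X ⟨i, j, u⟩ ⟨i', k, v⟩

/-- Because the Jordan matrix is block diagonal, the strips of the commutator decouple. -/
theorem jordanStrip_commutator (c : Fin t → ℂ) (X : Matrix (JordanIndex m) (JordanIndex m) ℂ)
    (i : Fin t) (j : Fin (r i)) (i' : Fin t) (k : Fin (r i')) :
    jordanStrip (X * jordanMatrix c m - jordanMatrix c m * X) i j i' k
      = jordanStrip X i j i' k * jordanBlock (m i' k) (c i')
        - jordanBlock (m i j) (c i) * jordanStrip X i j i' k := by
  ext u v
  change (X * jordanMatrix c m) _ _ - (jordanMatrix c m * X) _ _ = _ - _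
  simp only [Matrix.mul_apply, jordanMatrix, Fintype.sum_sigma, jordanStrip, Matrix.of_apply]
  congr 1
  · rw [Finset.sum_eq_single i', Finset.sum_eq_single k]
    · simp [Matrix.blockDiagonal'_apply_eq]
    · intro l _ hl
      simp [Matrix.blockDiagonal'_apply_eq, Matrix.blockDiagonal'_apply_ne _ _ _ hl]
    · simp
    · intro l _ hl
      simp [Matrix.blockDiagonal'_apply_ne _ _ _ hl]
    · simp
  · rw [Finset.sum_eq_single i, Finset.sum_eq_single j]
    · simp [Matrix.blockDiagonal'_apply_eq]
    · intro l _ hl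
      simp [Matrix.blockDiagonal'_apply_eq, Matrix.blockDiagonal'_apply_ne _ _ _ hl.symm]
    · simp
    · intro l _ hl
      simp [Matrix.blockDiagonal'_apply_ne _ _ _ hl.symm]
    · simp

theorem mem_starPositions {i i' : Fin t} {j : Fin (r i)} {k : Fin (r i')}
    {u : Fin (m i j)} {v : Fin (m i' k)} :
    ((⟨i, j, u⟩, ⟨i', k, v⟩) : JordanIndex m × JordanIndex m) ∈ starPositions m ↔
      i = i' ∧ ((j.val ≤ k.val ∧ u.val + 1 = m i j) ∨ (k.val < j.val ∧ v.val = 0)) := by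
  simp [starPositions]

theorem exists_jordanStrip_sylvester (c : Fin t → ℂ) (hc : Function.Injective c)
    (i : Fin t) (j : Fin (r i)) (i' : Fin t) (k : Fin (r i'))
    (Z : Matrix (Fin (m i j)) (Fin (m i' k)) ℂ) :
    ∃ X : Matrix (Fin (m i j)) (Fin (m i' k)) ℂ, ∀ u v,
      ((⟨i, j, u⟩, ⟨i', k, v⟩) : JordanIndex m × JordanIndex m) ∉ starPositions m →
        (X * jordanBlock (m i' k) (c i') - jordanBlock (m i j) (c i) * X) u v = Z u v := by
  simp only [mem_starPositions]
  by_cases hi : i = i'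
  · subst hi
    rcases le_or_gt j.val k.val with hjk | hjk
    · obtain ⟨X, hX⟩ := exists_sylvester_eq_off_last_row (c i) Z
      exact ⟨X, fun u v h => hX u v fun hu => h ⟨rfl, Or.inl ⟨hjk, hu⟩⟩⟩
    · obtain ⟨X, hX⟩ := exists_sylvester_eq_off_first_column (c i) Z
      exact ⟨X, fun u v h => hX u v fun hv => h ⟨rfl, Or.inr ⟨hjk, hv⟩⟩⟩
  · obtain ⟨X, hX⟩ := exists_sylvester_eq (fun h => hi (hc h)) Z
    exact ⟨X, fun u v _ => by rw [hX]⟩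

/-- The ordering of block sizes enters here: `j ≤ k` gives `m i k ≤ m i j`, as the last-row case
needs, and `k < j` gives the reverse for the first-column case. -/
theorem jordanStrip_sylvester_eq_zero (hm : ∀ i, Antitone (m i)) (c : Fin t → ℂ)
    (i : Fin t) (j : Fin (r i)) (i' : Fin t) (k : Fin (r i'))
    (X : Matrix (Fin (m i j)) (Fin (m i' k)) ℂ)
    (h : ∀ u v, ((⟨i, j, u⟩, ⟨i', k, v⟩) : JordanIndex m × JordanIndex m) ∉ starPositions m →
        (X * jordanBlock (m i' k) (c i') - jordanBlock (m i j) (c i) * X) u v = 0) :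
    X * jordanBlock (m i' k) (c i') - jordanBlock (m i j) (c i) * X = 0 := by
  simp only [mem_starPositions] at h
  by_cases hi : i = i'
  · subst hi
    rcases le_or_gt j.val k.val with hjk | hjk
    · refine sylvester_eq_zero_of_last_row (hm i hjk) _ X fun u v hu => h u v ?_
      rintro ⟨-, ⟨-, h1⟩ | ⟨h1, -⟩⟩
      exacts [hu h1, hjk.not_gt h1]
    · refine sylvester_eq_zero_of_first_column (hm i (le_of_lt hjk)) _ X fun u v hv => h u v ?_
      rintro ⟨-, ⟨h1, -⟩ | ⟨-, h1⟩⟩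
      exacts [hjk.not_ge h1, hv h1]
  · ext u v
    exact h u v fun h => hi h.1

theorem exists_commutator_jordanMatrix_eq_off_stars (c : Fin t → ℂ) (hc : Function.Injective c)
    (Z : Matrix (JordanIndex m) (JordanIndex m) ℂ) :
    ∃ Y : Matrix (JordanIndex m) (JordanIndex m) ℂ, ∀ p : JordanIndex m × JordanIndex m,
      p ∉ starPositions m →
        (Y * jordanMatrix c m - jordanMatrix c m * Y) p.1 p.2 = Z p.1 p.2 := by
  choose X hX using fun i j i' k =>
    exists_jordanStrip_sylvester c hc i j i' k (jordanStrip Z i j i' k)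
  refine ⟨Matrix.of fun p q => X p.1 p.2.1 q.1 q.2.1 p.2.2 q.2.2, ?_⟩
  rintro ⟨⟨i, j, u⟩, ⟨i', k, v⟩⟩ hp
  have h := hX i j i' k u v hp
  have hs := congrFun (congrFun (jordanStrip_commutator c
    (Matrix.of fun p q => X p.1 p.2.1 q.1 q.2.1 p.2.2 q.2.2) i j i' k) u) v
  exact hs.trans h

theorem commutator_jordanMatrix_eq_zero (hm : ∀ i, Antitone (m i)) (c : Fin t → ℂ)
    (Y : Matrix (JordanIndex m) (JordanIndex m) ℂ)
    (h : ∀ p : JordanIndex m × JordanIndex m, p ∉ starPositions m →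
      (Y * jordanMatrix c m - jordanMatrix c m * Y) p.1 p.2 = 0) :
    Y * jordanMatrix c m - jordanMatrix c m * Y = 0 := by
  ext ⟨i, j, u⟩ ⟨i', k, v⟩
  have hs := jordanStrip_commutator c Y i j i' k
  have h0 := jordanStrip_sylvester_eq_zero hm c i j i' k (jordanStrip Y i j i' k) fun u v huv => by
    rw [← hs]
    exact h _ huv
  exact congrFun (congrFun (hs.trans h0) u) v

end JordanMatrix

theorem theorem2p1 {t : ℕ} {r : Fin t → ℕ} (c : Fin t → ℂ) (m : (i : Fin t) → Fin (r i) → ℕ)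
    (hc : Function.Injective c) (hm : ∀ i, Antitone (m i)) :
    ReducesToPattern (jordanMatrix c m) (starPositions m) ∧
    (∀ P : Finset (JordanIndex m × JordanIndex m),
      ReducesToPattern (jordanMatrix c m) P → (starPositions m).card ≤ P.card) ∧
    (∀ (k : ℕ) (F : (Fin k → ℂ) → Matrix (JordanIndex m) (JordanIndex m) ℂ),
      ReducesToFamily (jordanMatrix c m) F → (starPositions m).card ≤ k) ∧
    (starPositions m).card = similarityCodim (jordanMatrix c m) := by
  have hspan := exists_commutator_jordanMatrix_eq_off_stars (m := m) c hc
  have hcard := card_eq_similarityCodim hspan (commutator_jordanMatrix_eq_zero hm c)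
  refine ⟨reducesToPattern_of_span hspan, fun P hP => ?_, fun k F hF => ?_, hcard⟩
  · obtain ⟨F, hF⟩ := hP.exists_reducesToFamily
    exact hcard.trans_le (similarityCodim_le_of_reducesToFamily hF)
  · exact hcard.trans_le (similarityCodim_le_of_reducesToFamily hF)
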